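/- Let $D$ be an oriented diagram, with $N\ge 1$ crossings $c_1,\dots,c_N$, of a knot $K\subset S^3$, with arcs $\mathfrak a_1,\dots,\mathfrak a_N$ indexed so that $\mathfrak a_n$ ends at the under-passage of $c_n$. Let $m_1,\dots,m_N$ be the generators of the Wirtinger presentation of the knot group $G_K$: at a crossing with incoming under-arc $\mathfrak a_i$, outgoing under-arc $\mathfrak a_j$ and over-arc $\mathfrak a_k$ the relation is $m_j=m_k^{-1}m_im_k$ if the crossing is positive, and $m_j=m_km_im_k^{-1}$ if it is negative. A representation $\rho:G_K\to SL(2,\mathbb C)$ is called parabolic if it is non-abelian and $\operatorname{tr}\rho(m)=2$, $\rho(m)\ne I$ for every meridian $m$. Let $X_{par}$ be the set of parabolic representations, where $\rho,\rho'$ are identified when $\operatorname{tr}\rho(a)=\operatorname{tr}\rho'(a)$ for all $a\in G_K$, and let $X_{par}^{(0)}$ be its zero-dimensional part, that is, the set of points of $X_{par}$ that are isolated in the Zariski topology given by the trace coordinates (so $X_{par}^{(0)}=X_{par}$ if $X_{par}$ is finite, i.e. zero-dimensional). For $a=\binom{x}{y}\in\mathbb C^2$ let $M(a)=\begin{pmatrix}1-xy&x^2\\-y^2&1+xy\end{pmatrix}\in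 SL(2,\mathbb C)$. For $\epsilon\in\{\pm1\}^N$, let $Q_\epsilon^{(0)}$ be the set of arc-colorings $(a_1,\dots,a_N)\in(\mathbb C^2)^N$ of sign-type $\epsilon$, i.e. such that at each crossing $c_n$ (with arcs $i=n$, $j$, $k$ as above) $\epsilon_n a_j=M(a_k)^{-1}a_i$ if $c_n$ is positive and $\epsilon_n a_j=M(a_k)a_i$ if $c_n$ is negative, for which $m_i\mapsto M(a_i)$ defines a parabolic representation whose class lies in $X_{par}^{(0)}$. Fix two sign-types $\epsilon_+,\epsilon_-\in\{\pm1\}^N$ whose entries have product $+1$ and $-1$, respectively, and let $\widetilde Q$ be the quotient of $Q_{\epsilon_+}^{(0)}\cup Q_{\epsilon_-}^{(0)}$ by the left multiplication $(a_1,\dots,a_N)\mapsto(Ba_1,\dots,Ba_N)$, $B\in SL(2,\mathbb C)$. For any indices $i,j\in\{1,\dots,N\}$ define the generalized Riley polynomial and the $u$-polynomial by $$R_{ij}(y)=\prod_{\rho\in X_{par}^{(0)}}\bigl(y-(2-\operatorname{tr}\rho(m_im_j))\bigr),\qquad g_{ij}(u)=\prod_{[a]\in\widetilde Q}\bigl(u-\det(a_i,a_j)\bigr).$$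 Then $X_{par}^{(0)}$ and $\widetilde Q$ are finite, $R_{ij}(y)$ has rational coefficients, $g_{ij}(u)$ has rational coefficients, and $R_{ij}$ is square-splitting: $$R_{ij}(u^2)=g_{ij}(u)\,g_{ij}^*(u),\qquad\text{where } g^*(u)=(-1)^{\deg g}g(-u).$$ -/

import Mathlib

open Polynomial
open scoped MatrixGroups

/-! ## Oriented knot diagrams

An oriented knot diagram is given by its crossings, by the cyclic order in which the knot runs through
them (each crossing is passed twice, once on the over-strand and once on the under-strand), and by the
signs of the crossings.  Planarity is Euler's formula for the underlying four-valent graph. -/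

/-- A passage of the knot through one of `n` crossings: `(c, true)` is the passage along the
over-strand at `c`, and `(c, false)` the passage along the under-strand at `c`. -/
abbrev Pass (n : ℕ) : Type := Fin n × Bool

/-- Half-edges of the diagram: `(p, true)` is the half-edge along which the knot leaves the passage `p`,
and `(p, false)` is the half-edge along which it arrives at `p`. -/
abbrev HalfEdge (n : ℕ) : Type := Pass n × Bool

/-- The other half of the same edge: the edge that leaves `p` arrives at `next p`. -/
def otherHalf {n : ℕ} (next : Equiv.Perm (Pass n)) : HalfEdge n → HalfEdge n
  | (p, true) => (next p, false)
  | (p, false) => (next.symm p, true)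

/-- The next half-edge in counterclockwise direction around the same crossing.  At a positive crossing
the counterclockwise order is over-out, under-out, over-in, under-in; at a negative crossing it is
over-out, under-in, over-in, under-out. -/
def rotateCCW {n : ℕ} (sign : Fin n → ℤˣ) : HalfEdge n → HalfEdge n
  | ((c, true), d) => ((c, false), if sign c = 1 then d else !d)
  | ((c, false), d) => ((c, true), if sign c = 1 then !d else d)

/-- The number of faces of the four-valent graph on the surface determined by the rotations: the number
of orbits of the (bijective) map `rotateCCW ∘ otherHalf` on half-edges. -/
noncomputable def faceCount {n : ℕ} (next : Equiv.Perm (Pass n)) (sign : Fin n → ℤˣ) : ℕ :=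
  Nat.card (Quot fun d e : HalfEdge n => e = rotateCCW sign (otherHalf next d))

/-- An oriented knot diagram (with at least one crossing) on the sphere. -/
structure KnotDiagram where
  /-- the number of crossings -/
  n : ℕ
  /-- the passage that follows a given passage along the oriented knot -/
  next : Equiv.Perm (Pass n)
  /-- the diagram has only one component -/
  one_component : next.IsCycleOn Set.univ
  /-- the signs of the crossings -/
  sign : Fin n → ℤˣ
  /-- planarity: `V - E + F = 2`, with `V = n` vertices and `E = 2 n` edges -/
  planar : faceCount next sign = n + 2

namespace KnotDiagram

variable (D : KnotDiagram)

theorem exists_iterate_under (p : Pass D.n) : ∃ k : ℕ, (D.next^[k] p).2 = false := by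
  obtain ⟨k, hk⟩ := (D.one_component.2 (Set.mem_univ p)
    (Set.mem_univ ((p.1, false) : Pass D.n))).exists_nat_pow_eq
  exact ⟨k, by rw [Equiv.Perm.iterate_eq_pow, hk]⟩

/-- The arcs of the diagram run from one under-passage to the next one.  There are as many arcs as
crossings, and arc `c` is the arc that ends at crossing `c`.  `D.arcAt p` is the arc on which the knot
arrives at the passage `p`, that is, the arc that ends at the first under-passage at or after `p`. -/
def arcAt (p : Pass D.n) : Fin D.n :=
  (D.next^[Nat.find (D.exists_iterate_under p)] p).1

/-- The over-arc at the crossing `c`. -/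
def overArc (c : Fin D.n) : Fin D.n := D.arcAt (c, true)

/-- The arc that starts at the under-passage of `c`.
(The arc that ends there is the arc `c` itself.) -/
def outArc (c : Fin D.n) : Fin D.n := D.arcAt (D.next (c, false))

/-! ## The knot group and its parabolic representations -/

/-- The Wirtinger relator at a crossing with incoming under-arc `i = c`, outgoing under-arc `j` and
over-arc `k`: it is `m_j⁻¹ m_k⁻¹ m_i m_k` if the crossing is positive and `m_j⁻¹ m_k m_i m_k⁻¹` if it is
negative. -/
def relator (c : Fin D.n) : FreeGroup (Fin D.n) :=
  let m : Fin D.n → FreeGroup (Fin D.n) := FreeGroup.of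
  if D.sign c = 1 then (m (D.outArc c))⁻¹ * (m (D.overArc c))⁻¹ * m c * m (D.overArc c)
  else (m (D.outArc c))⁻¹ * m (D.overArc c) * m c * (m (D.overArc c))⁻¹

/-- The knot group, in its Wirtinger presentation. -/
abbrev knotGroup : Type := PresentedGroup (Set.range D.relator)

/-- The Wirtinger generator of the arc `i`. -/
def gen (i : Fin D.n) : D.knotGroup := PresentedGroup.of i

/-- The (oriented) meridians: the conjugates of the Wirtinger generators. -/
def IsMeridian (g : D.knotGroup) : Prop := ∃ i, IsConj (D.gen i) g

/-- The character of a representation. -/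
def character (ρ : D.knotGroup →* SL(2, ℂ)) (g : D.knotGroup) : ℂ :=
  Matrix.trace (ρ g : Matrix (Fin 2) (Fin 2) ℂ)

/-- Parabolic representations: non-abelian, and every meridian is sent to a non-identity matrix of
trace `2`. -/
structure IsParabolic (ρ : D.knotGroup →* SL(2, ℂ)) : Prop where
  nonabelian : ¬ ∀ g h : D.knotGroup, Commute (ρ g) (ρ h)
  trace_eq : ∀ g, D.IsMeridian g → D.character ρ g = 2
  ne_one : ∀ g, D.IsMeridian g → ρ g ≠ 1

/-- `X_par`: the parabolic representations up to equality of characters, as a set of characters. -/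
def Xpar : Set (D.knotGroup → ℂ) := {χ | ∃ ρ, D.IsParabolic ρ ∧ D.character ρ = χ}

/-- The zero-dimensional part of `X_par`: the points `χ` that are isolated in the Zariski topology, that
is, `χ` is the only point of `X_par` in the principal open set of some polynomial in the trace
coordinates. -/
def Xpar0 : Set (D.knotGroup → ℂ) :=
  {χ | χ ∈ D.Xpar ∧ ∃ p : MvPolynomial D.knotGroup ℂ, MvPolynomial.eval χ p ≠ 0 ∧
    ∀ χ' ∈ D.Xpar, MvPolynomial.eval χ' p ≠ 0 → χ' = χ}

/-- If `X_par` is finite (zero-dimensional), its zero-dimensional part is all of it. -/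
theorem Xpar0_eq_of_finite (h : D.Xpar.Finite) : D.Xpar0 = D.Xpar := by
  classical
  refine Set.Subset.antisymm (fun χ hχ => hχ.1) fun χ hχ => ⟨hχ, ?_⟩
  have hsep : ∀ ψ : D.knotGroup → ℂ, ∃ p : MvPolynomial D.knotGroup ℂ,
      MvPolynomial.eval ψ p = 0 ∧ (ψ ≠ χ → MvPolynomial.eval χ p ≠ 0) := by
    intro ψ
    by_cases hψ : ψ = χ
    · exact ⟨0, by simp, fun h => absurd hψ h⟩
    · obtain ⟨g, hg⟩ := Function.ne_iff.mp hψ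
      exact ⟨MvPolynomial.X g - MvPolynomial.C (ψ g), by simp,
        fun _ => by simpa [sub_eq_zero] using fun h => hg h.symm⟩
  choose p hp0 hp1 using hsep
  refine ⟨∏ ψ ∈ h.toFinset.erase χ, p ψ, ?_, ?_⟩
  · rw [map_prod]
    exact Finset.prod_ne_zero_iff.mpr fun ψ hψ => hp1 ψ (Finset.mem_erase.mp hψ).1
  · intro χ' hχ' hne
    by_contra hcon
    apply hne
    rw [map_prod]
    exact Finset.prod_eq_zero
      (Finset.mem_erase.mpr ⟨hcon, h.mem_toFinset.mpr hχ'⟩) (hp0 χ')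

/-- The generalized Riley polynomial `R_ij(y) = ∏ (y - y_ij(ρ))` with `y_ij(ρ) = 2 - tr ρ(m_i m_j)`. -/
noncomputable def rileyPoly (i j : Fin D.n) : ℂ[X] :=
  ∏ᶠ χ ∈ D.Xpar0, (X - C (2 - χ (D.gen i * D.gen j)))

end KnotDiagram

/-! ## Parabolic quandle and u-polynomials -/

/-- The parabolic quandle map from `ℂ²` to the matrices in `SL(2, ℂ)` of trace `2`. -/
def quandleMap (v : Fin 2 → ℂ) : SL(2, ℂ) :=
  ⟨!![1 - v 0 * v 1, v 0 ^ 2; -(v 1) ^ 2, 1 + v 0 * v 1], by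
    rw [Matrix.det_fin_two_of]; ring⟩

/-- The determinant form on `ℂ²`. -/
def detForm (a b : Fin 2 → ℂ) : ℂ := a 0 * b 1 - a 1 * b 0

theorem detForm_mulVec (B : SL(2, ℂ)) (a b : Fin 2 → ℂ) :
    detForm ((B : Matrix (Fin 2) (Fin 2) ℂ).mulVec a) ((B : Matrix (Fin 2) (Fin 2) ℂ).mulVec b) =
      detForm a b := by
  have h := B.det_coe
  rw [Matrix.det_fin_two] at h
  simp only [detForm, Matrix.mulVec, dotProduct, Fin.sum_univ_two]
  linear_combination (a 0 * b 1 - a 1 * b 0) * h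

namespace KnotDiagram

variable (D : KnotDiagram)

/-- `a` satisfies the parabolic quandle relations of sign-type `ε`: at a crossing with incoming under-arc
`i = c`, outgoing under-arc `j` and over-arc `k`, `ε_c a_j = M(a_k)⁻¹ a_i` if the crossing is positive and
`ε_c a_j = M(a_k) a_i` if it is negative, where `M` is the parabolic quandle map. -/
def HasSignType (ε : Fin D.n → ℤˣ) (a : Fin D.n → Fin 2 → ℂ) : Prop :=
  ∀ c, (ε c : ℤ) • a (D.outArc c) =
    ((if D.sign c = 1 then (quandleMap (a (D.overArc c)))⁻¹ else quandleMap (a (D.overArc c)) :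
      SL(2, ℂ)) : Matrix (Fin 2) (Fin 2) ℂ).mulVec (a c)

/-- The arc-colorings of sign-type `ε₁` or `ε₂` whose associated representation (the one that sends `m_i`
to `M(a_i)`) is parabolic with character in the zero-dimensional part of `X_par`. -/
def Coloring (ε₁ ε₂ : Fin D.n → ℤˣ) : Type :=
  {a : Fin D.n → Fin 2 → ℂ // (D.HasSignType ε₁ a ∨ D.HasSignType ε₂ a) ∧
    ∃ ρ, D.IsParabolic ρ ∧ D.character ρ ∈ D.Xpar0 ∧ ∀ i, ρ (D.gen i) = quandleMap (a i)}

/-- Arc-colorings up to the left multiplication by `SL(2, ℂ)`. -/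
def coloringSetoid (ε₁ ε₂ : Fin D.n → ℤˣ) : Setoid (D.Coloring ε₁ ε₂) where
  r a b := ∃ B : SL(2, ℂ), ∀ i, b.1 i = (B : Matrix (Fin 2) (Fin 2) ℂ).mulVec (a.1 i)
  iseqv :=
    { refl := fun a => ⟨1, fun i => by simp⟩
      symm := by
        rintro a b ⟨B, hB⟩
        refine ⟨B⁻¹, fun i => ?_⟩
        rw [hB i, Matrix.mulVec_mulVec, ← Matrix.SpecialLinearGroup.coe_mul]
        simp
      trans := by
        rintro a b c ⟨B, hB⟩ ⟨B', hB'⟩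
        refine ⟨B' * B, fun i => ?_⟩
        rw [hB' i, hB i, Matrix.mulVec_mulVec, ← Matrix.SpecialLinearGroup.coe_mul] }

/-- The `u`-value `u_ij = det (a_i, a_j)` of a class of arc-colorings. -/
def uValue (ε₁ ε₂ : Fin D.n → ℤˣ) (i j : Fin D.n) :
    Quotient (D.coloringSetoid ε₁ ε₂) → ℂ :=
  Quotient.lift (fun a => detForm (a.1 i) (a.1 j)) (by
    rintro a b ⟨B, hB⟩
    simp only [hB, detForm_mulVec])

/-- The `u`-polynomial `g_ij(u) = ∏ (u - u_ij)`; the product runs over the classes of arc-colorings. -/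
noncomputable def uPoly (ε₁ ε₂ : Fin D.n → ℤˣ) (i j : Fin D.n) : ℂ[X] :=
  ∏ᶠ a : Quotient (D.coloringSetoid ε₁ ε₂), (X - C (D.uValue ε₁ ε₂ i j a))

end KnotDiagram

/-- `g^*(u) = (-1)^{deg g} g(-u)`. -/
noncomputable def starPoly (g : ℚ[X]) : ℚ[X] := C ((-1) ^ g.natDegree) * g.comp (-X)

/-! ## Automorphisms of algebraically closed fields -/

/-- Every automorphism of the polynomial ring on a transcendence basis extends to the algebraically
closed field. -/
theorem IsTranscendenceBasis.exists_ringEquiv_extending {K L ι : Type*} [Field K] [Field L]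
    [IsAlgClosed L] [Algebra K L] {v : ι → L} (hv : IsTranscendenceBasis K v)
    (φ : MvPolynomial ι K ≃+* MvPolynomial ι K) :
    ∃ Φ : L ≃+* L, ∀ p, Φ (MvPolynomial.aeval v p) = MvPolynomial.aeval v (φ p) := by
  let := IsAlgClosed.isAlgClosure_of_transcendence_basis v hv
  let e : Algebra.adjoin K (Set.range v) ≃+* Algebra.adjoin K (Set.range v) :=
    hv.1.aevalEquiv.symm.toRingEquiv.trans (φ.trans hv.1.aevalEquiv.toRingEquiv)
  refine ⟨IsAlgClosure.equivOfEquiv L L e, fun p => ?_⟩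
  have h := IsAlgClosure.equivOfEquiv_algebraMap L L e (hv.1.aevalEquiv p)
  simpa [e] using h

theorem mem_range_algebraMap_rat_of_forall_ringEquiv {L : Type*} [Field L] [IsAlgClosed L]
    [CharZero L] {z : L} (hz : ∀ σ : L ≃+* L, σ z = z) : z ∈ (algebraMap ℚ L).range := by
  let K := algebraicClosure ℚ L
  by_cases hzK : z ∈ K
  · obtain ⟨s, hs⟩ := exists_isTranscendenceBasis K L
    have : IsAlgClosure ℚ K := algebraicClosure.isAlgClosure ℚ L
    have hfix : ∀ σ : Gal(K/ℚ), σ ⟨z, hzK⟩ = ⟨z, hzK⟩ := by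
      intro σ
      obtain ⟨Φ, hΦ⟩ := hs.exists_ringEquiv_extending
        (MvPolynomial.mapEquiv s σ.toRingEquiv)
      have h := hΦ (MvPolynomial.C ⟨z, hzK⟩)
      simp only [MvPolynomial.mapEquiv_apply, MvPolynomial.map_C, MvPolynomial.algHom_C] at h
      have h2 : Φ z = algebraMap K L (σ ⟨z, hzK⟩) := h
      rw [hz] at h2
      exact Subtype.ext h2.symm
    obtain ⟨q, hq⟩ := (InfiniteGalois.mem_bot_iff_fixed (k := ℚ) (K := K) ⟨z, hzK⟩).2 hfix
    exact ⟨q, by simpa using congrArg (algebraMap K L) hq⟩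
  · exfalso
    have htr : Transcendental K z := by
      intro h
      have : Algebra.IsAlgebraic ℚ K := algebraicClosure.isAlgebraic ℚ L
      have := h.restrictScalars ℚ
      exact hzK (mem_algebraicClosure_iff.2 this)
    obtain ⟨s, hs, hsb⟩ := exists_isTranscendenceBasis_superset (R := K) (s := {z})
      ((algebraicIndependent_singleton_iff (⟨z, rfl⟩ : ({z} : Set L))).2 htr)
    let φ : MvPolynomial s K ≃ₐ[K] MvPolynomial s K :=
      AlgEquiv.ofAlgHom (MvPolynomial.aeval fun i => MvPolynomial.X i + 1)
        (MvPolynomial.aeval fun i => MvPolynomial.X i - 1) (by ext; simp) (by ext; simp)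
    obtain ⟨Φ, hΦ⟩ := hsb.exists_ringEquiv_extending φ.toRingEquiv
    have h := hΦ (MvPolynomial.X ⟨z, hs rfl⟩)
    simp [φ, hz] at h

theorem Polynomial.exists_map_rat_eq_of_forall_ringEquiv {L : Type*} [Field L] [IsAlgClosed L]
    [CharZero L] {f : L[X]} (hf : ∀ σ : L ≃+* L, f.map (σ : L →+* L) = f) :
    ∃ g : ℚ[X], g.map (algebraMap ℚ L) = f := by
  have h : f ∈ Polynomial.lifts (algebraMap ℚ L) := by
    rw [Polynomial.lifts_iff_coeff_lifts]
    intro k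
    refine mem_range_algebraMap_rat_of_forall_ringEquiv fun σ => ?_
    simpa using congrArg (fun p => p.coeff k) (hf σ)
  exact (Polynomial.mem_lifts f).1 h

/-! ## Signs along a cycle -/

/-- Along a transitive map of a finite set, a family of signs with product `1` is a coboundary. -/
theorem exists_sign_coboundary {ι : Type*} [Fintype ι] (f : ι → ι)
    (hf : ∀ c d, ∃ m, f^[m] c = d) (ε : ι → ℤˣ) (hε : ∏ c, ε c = 1) :
    ∃ s : ι → ℤˣ, ∀ c, s (f c) = ε c * s c := by
  classical
  rcases isEmpty_or_nonempty ι with hι | ⟨⟨c₀⟩⟩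
  · exact ⟨fun _ => 1, fun c => hι.elim c⟩
  have hsurj : Function.Surjective f := fun d => by
    obtain ⟨m, hm⟩ := hf (f d) d
    exact ⟨f^[m] d, by rw [← Function.iterate_succ_apply' f, Function.iterate_succ_apply, hm]⟩
  let e : Equiv.Perm ι := Equiv.ofBijective f (Finite.injective_iff_bijective.1
    (Finite.injective_iff_surjective.2 hsurj))
  have hef : ∀ m c, (e ^ m) c = f^[m] c := fun m c => by
    rw [← Equiv.Perm.iterate_eq_pow]; rfl
  have hcyc : e.IsCycleOn ((Finset.univ : Finset ι) : Set ι) := by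
    refine ⟨by simp, fun c _ d _ => ?_⟩
    obtain ⟨m, hm⟩ := hf c d
    exact ⟨m, by rw [zpow_natCast, hef, hm]⟩
  let n := Fintype.card ι
  have hn : ∀ m m' : ℕ, f^[m] c₀ = f^[m'] c₀ ↔ m ≡ m' [MOD n] := fun m m' => by
    rw [← hef, ← hef]
    exact hcyc.pow_apply_eq_pow_apply (Finset.mem_univ c₀)
  let P : ℕ → ℤˣ := fun m => ∏ k ∈ Finset.range m, ε (f^[k] c₀)
  have hPn : P n = 1 := by
    rw [← hε]
    refine Finset.prod_nbij (fun k => f^[k] c₀) (fun _ _ => Finset.mem_univ _) ?_ ?_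
      (fun _ _ => rfl)
    · intro k hk l hl h
      exact ((hn k l).1 h).eq_of_lt_of_lt (Finset.mem_range.1 hk) (Finset.mem_range.1 hl)
    · intro d _
      obtain ⟨m, hm, hmd⟩ := hcyc.exists_pow_eq (Finset.mem_univ c₀) (Finset.mem_univ d)
      exact ⟨m, Finset.mem_coe.2 (Finset.mem_range.2 hm), by rw [← hmd, hef]⟩
  have hper : Function.Periodic P n := fun m => by
    have h : ∀ k, f^[n + k] c₀ = f^[k] c₀ := fun k => (hn _ _).2 (by simp [Nat.ModEq])
    simp only [P]
    rw [add_comm m n, Finset.prod_range_add, show ∏ k ∈ Finset.range n, ε (f^[k] c₀) = 1 from hPn,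
      one_mul]
    exact Finset.prod_congr rfl fun k _ => by rw [h]
  choose m hm using hf c₀
  refine ⟨fun d => P (m d), fun c => ?_⟩
  have hmod : m (f c) ≡ m c + 1 [MOD n] := (hn _ _).1 (by
    rw [hm, Function.iterate_succ_apply', hm])
  have h1 : P (m (f c)) = P (m c + 1) := by
    rw [← hper.map_mod_nat, hmod, hper.map_mod_nat]
  change P (m (f c)) = ε c * P (m c)
  rw [h1]
  simp only [P]
  rw [Finset.prod_range_succ, hm, mul_comm]

namespace KnotDiagram

variable (D : KnotDiagram)

theorem arcAt_under (c : Fin D.n) : D.arcAt (c, false) = c := by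
  have h : Nat.find (D.exists_iterate_under (c, false)) = 0 := (Nat.find_eq_zero _).2 rfl
  rw [arcAt, h]
  rfl

theorem arcAt_next_over (c : Fin D.n) : D.arcAt (D.next (c, true)) = D.arcAt (c, true) := by
  have h := Nat.find_comp_succ (D.exists_iterate_under (c, true))
    (D.exists_iterate_under (D.next (c, true))) (by simp)
  rw [arcAt, arcAt, h]
  rfl

theorem exists_iterate_outArc (c d : Fin D.n) : ∃ m, D.outArc^[m] c = d := by
  have key : ∀ k, ∃ m, D.outArc^[m] c = D.arcAt (D.next^[k] (c, false)) := by
    intro k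
    induction k with
    | zero => exact ⟨0, (D.arcAt_under c).symm⟩
    | succ k ih =>
      obtain ⟨m, hm⟩ := ih
      rw [Function.iterate_succ_apply']
      generalize D.next^[k] (c, false) = p at hm
      obtain ⟨x, b⟩ := p
      cases b with
      | true => exact ⟨m, by rw [hm, arcAt_next_over]⟩
      | false =>
        refine ⟨m + 1, ?_⟩
        rw [Function.iterate_succ_apply', hm, arcAt_under]
        rfl
  obtain ⟨k, hk⟩ := (D.one_component.2 (Set.mem_univ ((c, false) : Pass D.n))
    (Set.mem_univ ((d, false) : Pass D.n))).exists_nat_pow_eq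
  obtain ⟨m, hm⟩ := key k
  exact ⟨m, by rw [hm, Equiv.Perm.iterate_eq_pow, hk, arcAt_under]⟩

theorem eq_of_outArc_eq {α : Type*} {s : Fin D.n → α} (hs : ∀ c, s (D.outArc c) = s c)
    (c d : Fin D.n) : s c = s d := by
  obtain ⟨m, rfl⟩ := D.exists_iterate_outArc c d
  induction m with
  | zero => rfl
  | succ m ih => rw [ih, Function.iterate_succ_apply', hs]

end KnotDiagram

/-! ## The parabolic quandle map -/

theorem coe_quandleMap (v : Fin 2 → ℂ) : (quandleMap v : Matrix (Fin 2) (Fin 2) ℂ) =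
    !![1 - v 0 * v 1, v 0 ^ 2; -(v 1) ^ 2, 1 + v 0 * v 1] := rfl

theorem quandleMap_zero : quandleMap 0 = 1 := by
  ext i j
  fin_cases i <;> fin_cases j <;> simp [quandleMap]

theorem quandleMap_mulVec (B : SL(2, ℂ)) (a : Fin 2 → ℂ) :
    quandleMap ((B : Matrix (Fin 2) (Fin 2) ℂ).mulVec a) = B * quandleMap a * B⁻¹ := by
  rw [eq_mul_inv_iff_mul_eq]
  have h := B.det_coe
  rw [Matrix.det_fin_two] at h
  ext i j
  rw [Matrix.SpecialLinearGroup.coe_mul, Matrix.SpecialLinearGroup.coe_mul, coe_quandleMap,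
    coe_quandleMap, Matrix.mul_apply, Matrix.mul_apply]
  simp only [Matrix.mulVec, dotProduct, Fin.sum_univ_two]
  fin_cases i <;> fin_cases j <;> simp
  · linear_combination (B.1 0 0 * a 0 * a 1 + B.1 0 1 * a 1 ^ 2) * (-h)
  · linear_combination (B.1 0 0 * a 0 ^ 2 + B.1 0 1 * a 1 * a 0) * h
  · linear_combination (B.1 1 0 * a 0 * a 1 + B.1 1 1 * a 1 ^ 2) * (-h)
  · linear_combination (B.1 1 0 * a 0 ^ 2 + B.1 1 1 * a 1 * a 0) * h

theorem quandleMap_neg (a : Fin 2 → ℂ) : quandleMap (-a) = quandleMap a := by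
  ext i j
  fin_cases i <;> fin_cases j <;> simp [quandleMap]

theorem quandleMap_unit_smul (s : ℤˣ) (a : Fin 2 → ℂ) :
    quandleMap ((s : ℤ) • a) = quandleMap a := by
  rcases Int.units_eq_one_or s with rfl | rfl
  · simp
  · simp [quandleMap_neg]

theorem exists_unit_smul_of_quandleMap_eq {a b : Fin 2 → ℂ} (h : quandleMap a = quandleMap b) :
    ∃ s : ℤˣ, (s : ℤ) • a = b := by
  have e : ∀ i j, (quandleMap a).1 i j = (quandleMap b).1 i j := fun i j => by rw [h]
  have h01 : a 0 ^ 2 = b 0 ^ 2 := by simpa [quandleMap] using e 0 1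
  have h10 : a 1 ^ 2 = b 1 ^ 2 := by simpa [quandleMap] using e 1 0
  have h00 : a 0 * a 1 = b 0 * b 1 := by simpa [quandleMap] using e 1 1
  suffices hab : a = b ∨ a = -b by
    rcases hab with rfl | rfl
    · exact ⟨1, by simp⟩
    · exact ⟨-1, by simp⟩
  have ext2 : ∀ u v : Fin 2 → ℂ, u 0 = v 0 → u 1 = v 1 → u = v := fun u v h0 h1 => by
    ext i; fin_cases i <;> assumption
  by_cases hb : b 0 = 0
  · have ha : a 0 = 0 := by simpa [hb] using h01
    rcases sq_eq_sq_iff_eq_or_eq_neg.1 h10 with h1 | h1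
    · exact Or.inl (ext2 _ _ (by rw [ha, hb]) h1)
    · exact Or.inr (ext2 _ _ (by simp [ha, hb]) (by simpa using h1))
  · rcases sq_eq_sq_iff_eq_or_eq_neg.1 h01 with h0 | h0
    · rw [h0] at h00
      exact Or.inl (ext2 _ _ h0 (mul_left_cancel₀ hb h00))
    · rw [h0] at h00
      exact Or.inr (ext2 _ _ (by simpa using h0)
        (mul_left_cancel₀ hb (by simp only [Pi.neg_apply]; linear_combination -h00)))

theorem exists_quandleMap_eq {A : SL(2, ℂ)}
    (hA : Matrix.trace (A : Matrix (Fin 2) (Fin 2) ℂ) = 2) : ∃ a, quandleMap a = A := by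
  have hd := A.det_coe
  rw [Matrix.det_fin_two] at hd
  rw [Matrix.trace_fin_two] at hA
  obtain ⟨x, hx⟩ := IsAlgClosed.exists_pow_nat_eq (A.1 0 1) (n := 2) (by norm_num)
  obtain ⟨y, hy⟩ := IsAlgClosed.exists_pow_nat_eq (-(A.1 1 0)) (n := 2) (by norm_num)
  have hxy : (x * y) ^ 2 = (1 - A.1 0 0) ^ 2 := by
    rw [mul_pow, hx, hy]
    linear_combination hd - A.1 0 0 * hA
  obtain ⟨y', hy', hxy'⟩ : ∃ y', y' ^ 2 = -(A.1 1 0) ∧ x * y' = 1 - A.1 0 0 := by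
    rcases sq_eq_sq_iff_eq_or_eq_neg.1 hxy with h | h
    · exact ⟨y, hy, h⟩
    · exact ⟨-y, by rw [neg_sq, hy], by rw [mul_neg, h, neg_neg]⟩
  refine ⟨![x, y'], ?_⟩
  ext i j
  fin_cases i <;> fin_cases j <;> simp [quandleMap, hx, hy', hxy']
  linear_combination -hA

theorem trace_quandleMap_mul (a b : Fin 2 → ℂ) :
    Matrix.trace ((quandleMap a * quandleMap b : SL(2, ℂ)) : Matrix (Fin 2) (Fin 2) ℂ) =
      2 - detForm a b ^ 2 := by
  rw [Matrix.SpecialLinearGroup.coe_mul, coe_quandleMap, coe_quandleMap]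
  simp [Matrix.trace_fin_two, detForm]
  ring

theorem quandleMap_commute_of_detForm_eq_zero {a b : Fin 2 → ℂ} (h : detForm a b = 0) :
    Commute (quandleMap a) (quandleMap b) := by
  unfold detForm at h
  ext i j
  rw [Matrix.SpecialLinearGroup.coe_mul, Matrix.SpecialLinearGroup.coe_mul, coe_quandleMap,
    coe_quandleMap]
  fin_cases i <;> fin_cases j <;> simp
  · linear_combination (-(a 0 * b 1 + a 1 * b 0)) * h
  · linear_combination (2 * a 0 * b 0) * h
  · linear_combination (-2 * a 1 * b 1) * h
  · linear_combination ((a 0 * b 1 + a 1 * b 0)) * h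

/-- Pairs of vectors with the same nonzero determinant differ by an element of `SL(2, ℂ)`. -/
theorem exists_mulVec_eq {a b a' b' : Fin 2 → ℂ} (h : detForm a b ≠ 0)
    (h' : detForm a' b' = detForm a b) :
    ∃ B : SL(2, ℂ), (B : Matrix (Fin 2) (Fin 2) ℂ).mulVec a = a' ∧
      (B : Matrix (Fin 2) (Fin 2) ℂ).mulVec b = b' := by
  obtain ⟨d, hd⟩ : ∃ d, d = detForm a b := ⟨_, rfl⟩
  rw [← hd] at h h'
  simp only [detForm] at h' hd
  refine ⟨⟨!![(a' 0 * b 1 - b' 0 * a 1) / d, (b' 0 * a 0 - a' 0 * b 0) / d;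
    (a' 1 * b 1 - b' 1 * a 1) / d, (b' 1 * a 0 - a' 1 * b 0) / d], ?_⟩, ?_, ?_⟩
  · rw [Matrix.det_fin_two_of]
    field_simp
    linear_combination (a 0 * b 1 - a 1 * b 0) * h' - d * hd
  · ext i
    fin_cases i <;> simp [Matrix.mulVec, dotProduct, Fin.sum_univ_two] <;> field_simp <;>
      rw [hd] <;> ring
  · ext i
    fin_cases i <;> simp [Matrix.mulVec, dotProduct, Fin.sum_univ_two] <;> field_simp <;>
      rw [hd] <;> ring

/-- A matrix that is trace-orthogonal to `1`, `M(a)`, `M(b)` and `M(a) M(b)` vanishes if `a`, `b` is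
a basis. -/
theorem eq_zero_of_trace_mul_quandleMap {a b : Fin 2 → ℂ} (hab : detForm a b ≠ 0)
    {Y : Matrix (Fin 2) (Fin 2) ℂ} (h1 : Matrix.trace Y = 0)
    (ha : Matrix.trace (Y * (quandleMap a).1) = 0)
    (hb : Matrix.trace (Y * (quandleMap b).1) = 0)
    (hc : Matrix.trace (Y * ((quandleMap a).1 * (quandleMap b).1)) = 0) : Y = 0 := by
  simp only [Matrix.trace_fin_two, quandleMap, Matrix.mul_apply, Fin.sum_univ_two,
    Matrix.of_apply, Matrix.cons_val_zero, Matrix.cons_val_one, Matrix.cons_val',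
    Matrix.cons_val_fin_one] at h1 ha hb hc
  have faa : a 0 * (Y 1 0 * a 0 + Y 1 1 * a 1) - a 1 * (Y 0 0 * a 0 + Y 0 1 * a 1) = 0 := by
    linear_combination ha - h1
  have fbb : b 0 * (Y 1 0 * b 0 + Y 1 1 * b 1) - b 1 * (Y 0 0 * b 0 + Y 0 1 * b 1) = 0 := by
    linear_combination hb - h1
  have fba : b 0 * (Y 1 0 * a 0 + Y 1 1 * a 1) - b 1 * (Y 0 0 * a 0 + Y 0 1 * a 1) = 0 := by
    refine mul_left_cancel₀ hab ?_
    simp only [detForm]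
    linear_combination hc - ha - hb + h1
  have fab : a 0 * (Y 1 0 * b 0 + Y 1 1 * b 1) - a 1 * (Y 0 0 * b 0 + Y 0 1 * b 1) = 0 := by
    linear_combination fba + (a 0 * b 1 - a 1 * b 0) * h1
  have solve : ∀ p q : ℂ, a 0 * q - a 1 * p = 0 → b 0 * q - b 1 * p = 0 → p = 0 ∧ q = 0 := by
    intro p q h h'
    constructor <;> refine mul_left_cancel₀ hab ?_ <;> simp only [detForm]
    · linear_combination b 0 * h - a 0 * h'
    · linear_combination b 1 * h - a 1 * h'
  obtain ⟨a0, a1⟩ := solve _ _ faa fba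
  obtain ⟨b0, b1⟩ := solve _ _ fab fbb
  have fin : ∀ p q : ℂ, p * a 0 + q * a 1 = 0 → p * b 0 + q * b 1 = 0 → p = 0 ∧ q = 0 := by
    intro p q h h'
    constructor <;> refine mul_left_cancel₀ hab ?_ <;> simp only [detForm]
    · linear_combination b 1 * h - a 1 * h'
    · linear_combination a 0 * h' - b 0 * h
  obtain ⟨y0, y1⟩ := fin _ _ a0 b0
  obtain ⟨y2, y3⟩ := fin _ _ a1 b1
  ext i j
  fin_cases i <;> fin_cases j <;> simpa

namespace KnotDiagram

variable (D : KnotDiagram)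

/-! ## The Wirtinger relations -/

/-- The group element by which the under-strand is conjugated at the crossing `c`. -/
def crossingElt (c : Fin D.n) : D.knotGroup :=
  if D.sign c = 1 then (D.gen (D.overArc c))⁻¹ else D.gen (D.overArc c)

/-- The matrix by which the under-strand is multiplied at the crossing `c` of a coloured diagram. -/
def crossingMatrix (a : Fin D.n → Fin 2 → ℂ) (c : Fin D.n) : SL(2, ℂ) :=
  if D.sign c = 1 then (quandleMap (a (D.overArc c)))⁻¹ else quandleMap (a (D.overArc c))

theorem hasSignType_iff {ε : Fin D.n → ℤˣ} {a : Fin D.n → Fin 2 → ℂ} :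
    D.HasSignType ε a ↔ ∀ c, (ε c : ℤ) • a (D.outArc c) =
      (D.crossingMatrix a c : Matrix (Fin 2) (Fin 2) ℂ).mulVec (a c) := Iff.rfl

theorem gen_outArc (c : Fin D.n) :
    D.gen (D.outArc c) = D.crossingElt c * D.gen c * (D.crossingElt c)⁻¹ := by
  have h : PresentedGroup.mk (Set.range D.relator) (D.relator c) = 1 :=
    PresentedGroup.one_of_mem ⟨c, rfl⟩
  have hg : ∀ i, PresentedGroup.mk (Set.range D.relator) (FreeGroup.of i) = D.gen i :=
    fun _ => rfl
  unfold crossingElt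
  by_cases hs : D.sign c = 1
  · simp only [relator, hs, if_true, map_mul, map_inv, hg] at h ⊢
    rw [inv_inv]
    simpa [mul_assoc, inv_mul_eq_one] using h
  · simp only [relator, hs, if_false, map_mul, map_inv, hg] at h ⊢
    simpa [mul_assoc, inv_mul_eq_one] using h

theorem gen_induction {p : D.knotGroup → Prop} (hgen : ∀ i, p (D.gen i)) (hone : p 1)
    (hmul : ∀ g h, p g → p h → p (g * h)) (hinv : ∀ g, p g → p g⁻¹) (g : D.knotGroup) : p g := by
  have hg : g ∈ Subgroup.closure (Set.range (PresentedGroup.of (rels := Set.range D.relator))) := by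
    rw [PresentedGroup.closure_range_of]
    trivial
  induction hg using Subgroup.closure_induction with
  | mem x hx => obtain ⟨i, rfl⟩ := hx; exact hgen i
  | one => exact hone
  | mul x y _ _ hx hy => exact hmul x y hx hy
  | inv x _ hx => exact hinv x hx

variable {D}

theorem hom_ext {G : Type*} [Group G] {ρ ρ' : D.knotGroup →* G}
    (h : ∀ i, ρ (D.gen i) = ρ' (D.gen i)) : ρ = ρ' :=
  PresentedGroup.ext h

theorem isMeridian_gen (i : Fin D.n) : D.IsMeridian (D.gen i) := ⟨i, IsConj.refl _⟩

/-! ## Colorings and representations -/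

section Colorings

variable {ρ ρ' : D.knotGroup →* SL(2, ℂ)} {a b : Fin D.n → Fin 2 → ℂ}

theorem map_crossingElt (ha : ∀ i, ρ (D.gen i) = quandleMap (a i)) (c : Fin D.n) :
    ρ (D.crossingElt c) = D.crossingMatrix a c := by
  unfold crossingElt crossingMatrix
  split_ifs <;> simp [ha]

theorem exists_hasSignType (ha : ∀ i, ρ (D.gen i) = quandleMap (a i)) :
    ∃ δ, D.HasSignType δ a := by
  have h : ∀ c, ∃ s : ℤˣ, (s : ℤ) • a (D.outArc c) =
      (D.crossingMatrix a c : Matrix (Fin 2) (Fin 2) ℂ).mulVec (a c) := fun c => by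
    apply exists_unit_smul_of_quandleMap_eq
    rw [quandleMap_mulVec, ← ha, gen_outArc, map_mul, map_mul, map_inv, map_crossingElt ha, ha]
  exact ⟨fun c => (h c).choose, fun c => (h c).choose_spec⟩

theorem crossingMatrix_unit_smul (s : Fin D.n → ℤˣ) (a : Fin D.n → Fin 2 → ℂ) (c : Fin D.n) :
    D.crossingMatrix (fun i => (s i : ℤ) • a i) c = D.crossingMatrix a c := by
  simp only [crossingMatrix, quandleMap_unit_smul]

/-- The sign-type of a coloring may be changed to any other one with the same product. -/
theorem HasSignType.exists_unit_smul {δ ε : Fin D.n → ℤˣ} (ha : D.HasSignType δ a)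
    (h : ∏ c, ε c = ∏ c, δ c) :
    ∃ s : Fin D.n → ℤˣ, D.HasSignType ε fun i => (s i : ℤ) • a i := by
  obtain ⟨s, hs⟩ := exists_sign_coboundary D.outArc D.exists_iterate_outArc (fun c => ε c * δ c)
    (by rw [Finset.prod_mul_distrib, h, Int.units_mul_self])
  refine ⟨s, D.hasSignType_iff.2 fun c => ?_⟩
  rw [crossingMatrix_unit_smul, Matrix.mulVec_smul, ← D.hasSignType_iff.1 ha c, hs, smul_smul,
    smul_smul, ← Units.val_mul, ← Units.val_mul]
  congr 2
  rw [← mul_assoc, ← mul_assoc, Int.units_mul_self, one_mul, mul_comm]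

theorem IsParabolic.exists_coloring (hρ : D.IsParabolic ρ) {ε₁ ε₂ : Fin D.n → ℤˣ}
    (h₁ : ∏ c, ε₁ c = 1) (h₂ : ∏ c, ε₂ c = -1) :
    ∃ a, (D.HasSignType ε₁ a ∨ D.HasSignType ε₂ a) ∧ ∀ i, ρ (D.gen i) = quandleMap (a i) := by
  choose a ha using fun i => exists_quandleMap_eq (hρ.trace_eq _ (isMeridian_gen i))
  obtain ⟨δ, hδ⟩ := exists_hasSignType fun i => (ha i).symm
  rcases Int.units_eq_one_or (∏ c, δ c) with h | h
  · obtain ⟨s, hs⟩ := hδ.exists_unit_smul (h₁.trans h.symm)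
    exact ⟨_, Or.inl hs, fun i => by rw [quandleMap_unit_smul, ha]⟩
  · obtain ⟨s, hs⟩ := hδ.exists_unit_smul (h₂.trans h.symm)
    exact ⟨_, Or.inr hs, fun i => by rw [quandleMap_unit_smul, ha]⟩

theorem IsParabolic.exists_detForm_ne_zero (hρ : D.IsParabolic ρ)
    (ha : ∀ i, ρ (D.gen i) = quandleMap (a i)) : ∃ p q, detForm (a p) (a q) ≠ 0 := by
  by_contra! h
  refine hρ.nonabelian fun x y => ?_
  induction x using D.gen_induction with
  | hgen i =>
    induction y using D.gen_induction with
    | hgen j => rw [ha, ha]; exact quandleMap_commute_of_detForm_eq_zero (h i j)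
    | hone => rw [map_one]; exact Commute.one_right _
    | hmul x y hx hy => rw [map_mul]; exact hx.mul_right hy
    | hinv x hx => rw [map_inv]; exact hx.inv_right
  | hone => rw [map_one]; exact Commute.one_left _
  | hmul x y hx hy => rw [map_mul]; exact hx.mul_left hy
  | hinv x hx => rw [map_inv]; exact hx.inv_left

theorem character_gen_mul_gen (ha : ∀ i, ρ (D.gen i) = quandleMap (a i)) (i j : Fin D.n) :
    D.character ρ (D.gen i * D.gen j) = 2 - detForm (a i) (a j) ^ 2 := by
  rw [character, map_mul, ha, ha, trace_quandleMap_mul]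

theorem trace_conj (B A : SL(2, ℂ)) :
    Matrix.trace ((B * A * B⁻¹ : SL(2, ℂ)) : Matrix (Fin 2) (Fin 2) ℂ) =
      Matrix.trace (A : Matrix (Fin 2) (Fin 2) ℂ) := by
  rw [Matrix.SpecialLinearGroup.coe_mul, Matrix.trace_mul_comm, ← Matrix.SpecialLinearGroup.coe_mul,
    inv_mul_cancel_left]

/-- Parabolic representations with the same character are conjugate. -/
theorem IsParabolic.exists_conj_of_character_eq (hρ : D.IsParabolic ρ) (hρ' : D.IsParabolic ρ')
    (h : D.character ρ = D.character ρ') : ∃ B : SL(2, ℂ), ∀ g, ρ' g = B * ρ g * B⁻¹ := by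
  choose a ha using fun i => exists_quandleMap_eq (hρ.trace_eq _ (isMeridian_gen i))
  choose b hb using fun i => exists_quandleMap_eq (hρ'.trace_eq _ (isMeridian_gen i))
  obtain ⟨p, q, hpq⟩ := hρ.exists_detForm_ne_zero fun i => (ha i).symm
  obtain ⟨v, hv, hdet⟩ : ∃ v, quandleMap v = ρ' (D.gen p) ∧
      detForm v (b q) = detForm (a p) (a q) := by
    have h2 := congrFun h (D.gen p * D.gen q)
    rw [character_gen_mul_gen (fun i => (ha i).symm),
      character_gen_mul_gen (fun i => (hb i).symm)] at h2
    have h3 : detForm (b p) (b q) ^ 2 = detForm (a p) (a q) ^ 2 := by linear_combination h2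
    rcases sq_eq_sq_iff_eq_or_eq_neg.1 h3 with h4 | h4
    · exact ⟨b p, hb p, h4⟩
    · refine ⟨-b p, by rw [quandleMap_neg, hb], ?_⟩
      simp only [detForm, Pi.neg_apply] at h4 ⊢
      linear_combination -h4
  obtain ⟨B, hBp, hBq⟩ := exists_mulVec_eq hpq hdet
  have hp : ρ' (D.gen p) = B * ρ (D.gen p) * B⁻¹ := by
    rw [← hv, ← hBp, quandleMap_mulVec, ha]
  have hq : ρ' (D.gen q) = B * ρ (D.gen q) * B⁻¹ := by
    rw [← hb, ← hBq, quandleMap_mulVec, ha]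
  refine ⟨B, fun g => Subtype.ext (sub_eq_zero.1 ?_)⟩
  have key : ∀ x, ρ' x = B * ρ x * B⁻¹ →
      Matrix.trace (((ρ' g).1 - (B * ρ g * B⁻¹).1) * (ρ' x).1) = 0 := by
    intro x hx
    rw [sub_mul, Matrix.trace_sub, sub_eq_zero]
    have h1 : Matrix.trace ((ρ' g).1 * (ρ' x).1) = D.character ρ' (g * x) := by
      rw [character, map_mul, Matrix.SpecialLinearGroup.coe_mul]
    have h2 : Matrix.trace ((B * ρ g * B⁻¹).1 * (ρ' x).1) = D.character ρ (g * x) := by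
      have e : B * (ρ g * ρ x) * B⁻¹ = B * ρ g * B⁻¹ * ρ' x := by rw [hx]; group
      rw [character, map_mul, ← trace_conj B, e, Matrix.SpecialLinearGroup.coe_mul _ (ρ' x)]
    rw [h1, h2, h]
  refine eq_zero_of_trace_mul_quandleMap (a := v) (b := b q) (by rwa [hdet]) ?_ ?_ ?_ ?_
  · simpa using key 1 (by simp)
  · rw [hv]; exact key _ hp
  · rw [hb]; exact key _ hq
  · rw [hv, hb, ← Matrix.SpecialLinearGroup.coe_mul, ← map_mul]
    refine key _ ?_
    rw [map_mul, map_mul, hp, hq]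
    group

theorem crossingMatrix_mulVec (B : SL(2, ℂ)) (a : Fin D.n → Fin 2 → ℂ) (c : Fin D.n) :
    D.crossingMatrix (fun i => (B : Matrix (Fin 2) (Fin 2) ℂ).mulVec (a i)) c =
      B * D.crossingMatrix a c * B⁻¹ := by
  unfold crossingMatrix
  split_ifs <;> simp only [quandleMap_mulVec]
  group

theorem unit_smul_injective {v : Fin 2 → ℂ} (hv : v ≠ 0) {s t : ℤˣ}
    (h : (s : ℤ) • v = (t : ℤ) • v) : s = t := by
  have hne : v ≠ -v := fun h => hv (self_eq_neg.1 h)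
  rcases Int.units_eq_one_or s with rfl | rfl <;> rcases Int.units_eq_one_or t with rfl | rfl
  · rfl
  · exact absurd (by simpa using h) hne
  · exact absurd (by simpa using h.symm) hne
  · rfl

/-- Colorings that induce conjugate representations have sign-types with the same product. If the
sign-types agree then the colorings are equivalent. -/
theorem IsParabolic.exists_mulVec_eq_unit_smul (hρ : D.IsParabolic ρ) {δ ε : Fin D.n → ℤˣ}
    (ha : ∀ i, ρ (D.gen i) = quandleMap (a i)) (hb : ∀ i, ρ' (D.gen i) = quandleMap (b i))
    (haδ : D.HasSignType δ a) (hbε : D.HasSignType ε b) {B : SL(2, ℂ)}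
    (hB : ∀ g, ρ' g = B * ρ g * B⁻¹) :
    ∃ s : Fin D.n → ℤˣ, (∀ i, b i = (s i : ℤ) • (B : Matrix (Fin 2) (Fin 2) ℂ).mulVec (a i)) ∧
      ∀ c, ε c * s (D.outArc c) = s c * δ c := by
  have h : ∀ i, ∃ s : ℤˣ, (s : ℤ) • (B : Matrix (Fin 2) (Fin 2) ℂ).mulVec (a i) = b i := fun i =>
    exists_unit_smul_of_quandleMap_eq (by rw [quandleMap_mulVec, ← ha, ← hB, hb])
  choose s hs using h
  refine ⟨s, fun i => (hs i).symm, fun c => ?_⟩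
  have hne : (B : Matrix (Fin 2) (Fin 2) ℂ).mulVec (a (D.outArc c)) ≠ 0 := by
    intro h0
    apply hρ.ne_one _ (isMeridian_gen (D.outArc c))
    have h1 := quandleMap_mulVec B (a (D.outArc c))
    rw [h0, quandleMap_zero, ← ha] at h1
    exact conj_eq_one_iff.1 h1.symm
  refine unit_smul_injective hne ?_
  have h1 := D.hasSignType_iff.1 hbε c
  have h2 : D.crossingMatrix b c = B * D.crossingMatrix a c * B⁻¹ := by
    rw [← crossingMatrix_mulVec, ←
      crossingMatrix_unit_smul s fun i => (B : Matrix (Fin 2) (Fin 2) ℂ).mulVec (a i)]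
    exact congrArg (D.crossingMatrix · c) (funext fun i => (hs i).symm)
  rw [h2, ← hs, ← hs, Matrix.mulVec_smul, Matrix.mulVec_mulVec, ← Matrix.SpecialLinearGroup.coe_mul,
    inv_mul_cancel_right, Matrix.SpecialLinearGroup.coe_mul, ← Matrix.mulVec_mulVec,
    ← D.hasSignType_iff.1 haδ c, Matrix.mulVec_smul, smul_smul, smul_smul] at h1
  rw [Units.val_mul, Units.val_mul, h1]

theorem prod_eq_of_coboundary {δ ε s : Fin D.n → ℤˣ}
    (h : ∀ c, ε c * s (D.outArc c) = s c * δ c) : ∏ c, ε c = ∏ c, δ c := by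
  have hsurj : Function.Surjective D.outArc := fun d => by
    obtain ⟨m, hm⟩ := D.exists_iterate_outArc (D.outArc d) d
    exact ⟨D.outArc^[m] d, by
      rw [← Function.iterate_succ_apply' D.outArc, Function.iterate_succ_apply, hm]⟩
  have hbij : Function.Bijective D.outArc :=
    Finite.injective_iff_bijective.1 (Finite.injective_iff_surjective.2 hsurj)
  have h1 : ∏ c, (ε c * s (D.outArc c)) = ∏ c, (s c * δ c) :=
    Finset.prod_congr rfl fun c _ => h c
  rw [Finset.prod_mul_distrib, Finset.prod_mul_distrib, hbij.prod_comp s, mul_comm] at h1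
  exact mul_left_cancel h1

theorem IsParabolic.exists_mulVec_eq (hρ : D.IsParabolic ρ) (hρ' : D.IsParabolic ρ')
    (h : D.character ρ = D.character ρ') {ε₁ ε₂ : Fin D.n → ℤˣ}
    (hε : ∏ c, ε₁ c ≠ ∏ c, ε₂ c)
    (ha : ∀ i, ρ (D.gen i) = quandleMap (a i)) (hb : ∀ i, ρ' (D.gen i) = quandleMap (b i))
    (haε : D.HasSignType ε₁ a ∨ D.HasSignType ε₂ a)
    (hbε : D.HasSignType ε₁ b ∨ D.HasSignType ε₂ b) :
    ∃ B : SL(2, ℂ), ∀ i, b i = (B : Matrix (Fin 2) (Fin 2) ℂ).mulVec (a i) := by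
  obtain ⟨B, hB⟩ := hρ.exists_conj_of_character_eq hρ' h
  have main : ∀ ε, D.HasSignType ε a → D.HasSignType ε b →
      ∃ B : SL(2, ℂ), ∀ i, b i = (B : Matrix (Fin 2) (Fin 2) ℂ).mulVec (a i) := by
    intro ε haε hbε
    obtain ⟨s, hs, hc⟩ := hρ.exists_mulVec_eq_unit_smul ha hb haε hbε hB
    have hconst := D.eq_of_outArc_eq (s := s) fun c =>
      mul_left_cancel ((hc c).trans (mul_comm _ _))
    by_cases h1 : ∀ i, s i = 1
    · exact ⟨B, fun i => by rw [hs, h1]; simp⟩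
    · push Not at h1
      obtain ⟨i₀, hi₀⟩ := h1
      refine ⟨-B, fun i => ?_⟩
      have h2 : s i = -1 := (hconst i i₀).trans ((Int.units_eq_one_or _).resolve_left hi₀)
      rw [hs, h2]
      simp [Matrix.neg_mulVec]
  rcases haε with h1 | h1 <;> rcases hbε with h2 | h2
  · exact main _ h1 h2
  · obtain ⟨s, -, hc⟩ := hρ.exists_mulVec_eq_unit_smul ha hb h1 h2 hB
    exact absurd (prod_eq_of_coboundary hc).symm hε
  · obtain ⟨s, -, hc⟩ := hρ.exists_mulVec_eq_unit_smul ha hb h1 h2 hB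
    exact absurd (prod_eq_of_coboundary hc) hε
  · exact main _ h1 h2

theorem character_eq_of_mulVec (ha : ∀ i, ρ (D.gen i) = quandleMap (a i))
    (hb : ∀ i, ρ' (D.gen i) = quandleMap (b i)) {B : SL(2, ℂ)}
    (hB : ∀ i, b i = (B : Matrix (Fin 2) (Fin 2) ℂ).mulVec (a i)) :
    D.character ρ = D.character ρ' := by
  have h : ρ' = (MulAut.conj B).toMonoidHom.comp ρ := hom_ext fun i => by
    change ρ' (D.gen i) = B * ρ (D.gen i) * B⁻¹
    rw [hb, hB, quandleMap_mulVec, ha]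
  ext g
  rw [h]
  exact (trace_conj B (ρ g)).symm

end Colorings

end KnotDiagram

/-! ## Finiteness of the zero-dimensional part -/

/-- In a subset of an affine space, only finitely many pairwise disjoint nonempty subsets can be cut
out by principal open sets. -/
theorem MvPolynomial.finite_of_disjoint_basicOpen {σ K ι : Type*} [Finite σ] [Field K]
    (x : ι → σ → K) (q : ι → MvPolynomial σ K)
    (h : ∀ k l, MvPolynomial.eval (x k) (q l) ≠ 0 ↔ k = l) : Finite ι := by
  by_contra hι
  rw [not_finite_iff_infinite] at hι
  let f : ℕ ↪ ι := Infinite.natEmbedding ι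
  let I : ℕ →o Ideal (MvPolynomial σ K) :=
    ⟨fun m => Ideal.span ((fun k => q (f k)) '' Set.Iio m), fun m m' hm =>
      Ideal.span_mono (Set.image_mono (Set.Iio_subset_Iio hm))⟩
  obtain ⟨m, hm⟩ := monotone_stabilizes_iff_noetherian.2
    (inferInstance : IsNoetherian (MvPolynomial σ K) (MvPolynomial σ K)) I
  have h1 : q (f m) ∈ I m := by
    rw [hm (m + 1) m.le_succ]
    exact Ideal.subset_span ⟨m, Nat.lt_succ_self m, rfl⟩
  have h2 : I m ≤ RingHom.ker (MvPolynomial.eval (x (f m))) := by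
    refine Ideal.span_le.2 ?_
    rintro _ ⟨k, hk, rfl⟩
    by_contra hne
    exact (ne_of_gt hk) (f.injective ((h _ _).1 hne))
  exact (h (f m) (f m)).2 rfl (h2 h1)

namespace KnotDiagram

variable (D : KnotDiagram)

/-- The matrix entries of the images of the Wirtinger generators. -/
def entries (ρ : D.knotGroup →* SL(2, ℂ)) (x : Fin D.n × Fin 2 × Fin 2) : ℂ :=
  (ρ (D.gen x.1)).1 x.2.1 x.2.2

theorem exists_matrix_eval_entries (g : D.knotGroup) :
    ∃ A : Matrix (Fin 2) (Fin 2) (MvPolynomial (Fin D.n × Fin 2 × Fin 2) ℂ),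
      ∀ ρ : D.knotGroup →* SL(2, ℂ), (MvPolynomial.eval (D.entries ρ)).mapMatrix A = (ρ g).1 := by
  induction g using D.gen_induction with
  | hgen i =>
    refine ⟨Matrix.of fun r s => MvPolynomial.X (i, r, s), fun ρ => ?_⟩
    ext r s
    simp [entries]
  | hone => exact ⟨1, fun ρ => by rw [map_one, map_one]; rfl⟩
  | hmul g h hg hh =>
    obtain ⟨A, hA⟩ := hg
    obtain ⟨A', hA'⟩ := hh
    exact ⟨A * A', fun ρ => by
      rw [map_mul, map_mul, hA, hA', Matrix.SpecialLinearGroup.coe_mul]⟩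
  | hinv g hg =>
    obtain ⟨A, hA⟩ := hg
    exact ⟨A.adjugate, fun ρ => by
      rw [RingHom.map_adjugate, hA, map_inv, Matrix.SpecialLinearGroup.coe_inv]⟩

theorem exists_eval_entries (g : D.knotGroup) :
    ∃ P : MvPolynomial (Fin D.n × Fin 2 × Fin 2) ℂ,
      ∀ ρ : D.knotGroup →* SL(2, ℂ), MvPolynomial.eval (D.entries ρ) P = D.character ρ g := by
  obtain ⟨A, hA⟩ := D.exists_matrix_eval_entries g
  exact ⟨A.trace, fun ρ => by
    rw [character, ← hA]
    exact AddMonoidHom.map_trace (MvPolynomial.eval (D.entries ρ)) A⟩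

theorem finite_Xpar0 : D.Xpar0.Finite := by
  choose P hP using D.exists_eval_entries
  choose ρ hρ hρχ using fun χ : D.Xpar0 => χ.2.1
  choose p hp hpχ using fun χ : D.Xpar0 => χ.2.2
  refine Set.finite_coe_iff.1 ?_
  refine MvPolynomial.finite_of_disjoint_basicOpen (fun χ : D.Xpar0 => D.entries (ρ χ))
    (fun χ => MvPolynomial.bind₁ P (p χ)) fun χ ψ => ?_
  have heval : MvPolynomial.eval (D.entries (ρ χ)) (MvPolynomial.bind₁ P (p ψ)) =
      MvPolynomial.eval χ.1 (p ψ) := by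
    rw [← MvPolynomial.coe_aeval_eq_eval, RingHom.coe_coe, MvPolynomial.aeval_bind₁,
      MvPolynomial.aeval_eq_eval]
    congr 2
    funext g
    rw [← hρχ χ, ← hP]
    rfl
  rw [heval]
  refine ⟨fun h => Subtype.ext (hpχ ψ χ.1 χ.2.1 h), ?_⟩
  rintro rfl
  exact hp χ

/-! ## The bijection between classes of colorings and characters -/

section Colorings

variable {D} {ε₁ ε₂ : Fin D.n → ℤˣ}

theorem exists_rep (a : D.Coloring ε₁ ε₂) : ∃ ρ, D.IsParabolic ρ ∧ D.character ρ ∈ D.Xpar0 ∧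
    ∀ i, ρ (D.gen i) = quandleMap (a.1 i) := a.2.2

/-- The representation associated with a coloring. -/
noncomputable def Coloring.rep (a : D.Coloring ε₁ ε₂) : D.knotGroup →* SL(2, ℂ) :=
  (exists_rep a).choose

theorem Coloring.isParabolic_rep (a : D.Coloring ε₁ ε₂) : D.IsParabolic a.rep :=
  (exists_rep a).choose_spec.1

theorem Coloring.character_rep_mem (a : D.Coloring ε₁ ε₂) : D.character a.rep ∈ D.Xpar0 :=
  (exists_rep a).choose_spec.2.1

theorem Coloring.rep_gen (a : D.Coloring ε₁ ε₂) (i : Fin D.n) :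
    a.rep (D.gen i) = quandleMap (a.1 i) :=
  (exists_rep a).choose_spec.2.2 i

variable (ε₁ ε₂)

/-- The character of a class of colorings. -/
noncomputable def classCharacter : Quotient (D.coloringSetoid ε₁ ε₂) → D.Xpar0 :=
  Quotient.lift (fun a => ⟨D.character a.rep, a.character_rep_mem⟩) (by
    rintro a b ⟨B, hB⟩
    exact Subtype.ext (character_eq_of_mulVec a.rep_gen b.rep_gen hB))

variable {ε₁ ε₂}

theorem classCharacter_gen_mul_gen (q : Quotient (D.coloringSetoid ε₁ ε₂)) (i j : Fin D.n) :
    (classCharacter ε₁ ε₂ q).1 (D.gen i * D.gen j) = 2 - D.uValue ε₁ ε₂ i j q ^ 2 := by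
  induction q using Quotient.inductionOn with
  | h a => exact character_gen_mul_gen a.rep_gen i j

theorem classCharacter_bijective (h₁ : ∏ c, ε₁ c = 1) (h₂ : ∏ c, ε₂ c = -1) :
    Function.Bijective (classCharacter (D := D) ε₁ ε₂) := by
  constructor
  · intro q r
    induction q, r using Quotient.inductionOn₂ with
    | h a b =>
      intro h
      refine Quotient.sound ?_
      exact a.isParabolic_rep.exists_mulVec_eq b.isParabolic_rep (congrArg Subtype.val h)
        (by rw [h₁, h₂]; decide) a.rep_gen b.rep_gen a.2.1 b.2.1
  · rintro ⟨χ, hχ⟩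
    obtain ⟨ρ, hρ, rfl⟩ := hχ.1
    obtain ⟨a, haε, ha⟩ := hρ.exists_coloring h₁ h₂
    let a' : D.Coloring ε₁ ε₂ := ⟨a, haε, ρ, hρ, hχ, ha⟩
    refine ⟨Quotient.mk _ a', Subtype.ext ?_⟩
    have h : a'.rep = ρ := hom_ext fun i => by rw [a'.rep_gen, ha]
    change D.character a'.rep = _
    rw [h]

end Colorings

/-! ## The action of the automorphisms of the complex numbers -/

section Galois

variable {D} (σ : ℂ ≃+* ℂ)

/-- The conjugate of a representation by an automorphism of the complex numbers. -/
def conjRep (ρ : D.knotGroup →* SL(2, ℂ)) : D.knotGroup →* SL(2, ℂ) :=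
  (Matrix.SpecialLinearGroup.map (σ : ℂ →+* ℂ)).comp ρ

theorem character_conjRep (ρ : D.knotGroup →* SL(2, ℂ)) :
    D.character (conjRep σ ρ) = fun g => σ (D.character ρ g) := by
  ext g
  exact (AddMonoidHom.map_trace (σ : ℂ →+* ℂ) (ρ g).1).symm

theorem map_injective : Function.Injective
    (Matrix.SpecialLinearGroup.map (n := Fin 2) (σ : ℂ →+* ℂ)) := by
  intro A B h
  ext i j
  have h1 := congrArg (fun C : SL(2, ℂ) => C.1 i j) h
  exact σ.injective h1

theorem IsParabolic.conjRep {ρ : D.knotGroup →* SL(2, ℂ)} (hρ : D.IsParabolic ρ) :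
    D.IsParabolic (conjRep σ ρ) where
  nonabelian h := hρ.nonabelian fun x y => map_injective σ (by
    rw [map_mul, map_mul]
    exact h x y)
  trace_eq g hg := by
    rw [character_conjRep]
    change σ (D.character ρ g) = 2
    rw [hρ.trace_eq g hg, map_ofNat]
  ne_one g hg h := hρ.ne_one g hg (map_injective σ (by rw [map_one]; exact h))

theorem conj_mem_Xpar {χ : D.knotGroup → ℂ} (hχ : χ ∈ D.Xpar) :
    (fun g => σ (χ g)) ∈ D.Xpar := by
  obtain ⟨ρ, hρ, rfl⟩ := hχ
  exact ⟨_, hρ.conjRep σ, character_conjRep σ ρ⟩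

theorem conj_mem_Xpar0 {χ : D.knotGroup → ℂ} (hχ : χ ∈ D.Xpar0) :
    (fun g => σ (χ g)) ∈ D.Xpar0 := by
  obtain ⟨hX, p, hp, hu⟩ := hχ
  have heval : ∀ ψ : D.knotGroup → ℂ,
      MvPolynomial.eval (fun g => σ (ψ g)) (MvPolynomial.map (σ : ℂ →+* ℂ) p) =
        σ (MvPolynomial.eval ψ p) := fun ψ =>
    (MvPolynomial.map_eval (σ : ℂ →+* ℂ) ψ p).symm
  refine ⟨conj_mem_Xpar σ hX, MvPolynomial.map (σ : ℂ →+* ℂ) p, ?_, fun χ' hχ' hne => ?_⟩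
  · rw [heval]
    simpa using hp
  · have h1 : χ' = fun g => σ (σ.symm (χ' g)) := by simp
    have h2 : (fun g => σ.symm (χ' g)) = χ := hu _ (conj_mem_Xpar σ.symm hχ') fun h0 => by
      rw [h1, heval, h0, map_zero] at hne
      exact hne rfl
    rw [h1, ← h2]

/-- The conjugate of a coloring by an automorphism of the complex numbers. -/
def conjColoring (a : Fin D.n → Fin 2 → ℂ) : Fin D.n → Fin 2 → ℂ := fun i k => σ (a i k)

theorem quandleMap_conj (v : Fin 2 → ℂ) : quandleMap (fun k => σ (v k)) =
    Matrix.SpecialLinearGroup.map (σ : ℂ →+* ℂ) (quandleMap v) := by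
  ext i j
  change _ = σ ((quandleMap v).1 i j)
  fin_cases i <;> fin_cases j <;> simp [quandleMap]

theorem conj_mulVec (B : SL(2, ℂ)) (v : Fin 2 → ℂ) :
    (Matrix.SpecialLinearGroup.map (σ : ℂ →+* ℂ) B : Matrix (Fin 2) (Fin 2) ℂ).mulVec
      (fun k => σ (v k)) = fun k => σ ((B : Matrix (Fin 2) (Fin 2) ℂ).mulVec v k) := by
  ext k
  exact (RingHom.map_mulVec (σ : ℂ →+* ℂ) B.1 v k).symm

theorem HasSignType.conj {ε : Fin D.n → ℤˣ} {a : Fin D.n → Fin 2 → ℂ} (h : D.HasSignType ε a) :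
    D.HasSignType ε (conjColoring σ a) := by
  refine D.hasSignType_iff.2 fun c => ?_
  have h1 : D.crossingMatrix (conjColoring σ a) c =
      Matrix.SpecialLinearGroup.map (σ : ℂ →+* ℂ) (D.crossingMatrix a c) := by
    unfold crossingMatrix conjColoring
    split_ifs <;> simp [quandleMap_conj]
  rw [h1]
  unfold conjColoring
  rw [conj_mulVec, ← D.hasSignType_iff.1 h c]
  ext k
  simp

variable (ε₁ ε₂ : Fin D.n → ℤˣ)

/-- The action of an automorphism of the complex numbers on classes of colorings. -/
def conjClass : Quotient (D.coloringSetoid ε₁ ε₂) → Quotient (D.coloringSetoid ε₁ ε₂) :=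
  Quotient.map' (fun a => ⟨conjColoring σ a.1, a.2.1.imp (·.conj σ) (·.conj σ), by
    obtain ⟨ρ, hρ, hχ, ha⟩ := a.2.2
    refine ⟨conjRep σ ρ, hρ.conjRep σ, ?_, fun i => ?_⟩
    · rw [character_conjRep]
      exact conj_mem_Xpar0 σ hχ
    · unfold conjColoring
      rw [quandleMap_conj, ← ha]
      rfl⟩) (by
    rintro a b ⟨B, hB⟩
    refine ⟨Matrix.SpecialLinearGroup.map (σ : ℂ →+* ℂ) B, fun i => ?_⟩
    change (fun k => σ (b.1 i k)) = Matrix.mulVec _ fun k => σ (a.1 i k)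
    rw [conj_mulVec, hB])

theorem conjClass_symm (q : Quotient (D.coloringSetoid ε₁ ε₂)) :
    conjClass σ ε₁ ε₂ (conjClass σ.symm ε₁ ε₂ q) = q := by
  induction q using Quotient.inductionOn with
  | h a =>
    refine congrArg (Quotient.mk _) (Subtype.ext ?_)
    funext i k
    exact σ.apply_symm_apply _

theorem conjClass_bijective : Function.Bijective (conjClass σ ε₁ ε₂) :=
  Function.bijective_iff_has_inverse.2
    ⟨conjClass σ.symm ε₁ ε₂, fun q => conjClass_symm σ.symm ε₁ ε₂ q, conjClass_symm σ ε₁ ε₂⟩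

theorem uValue_conjClass (i j : Fin D.n) (q : Quotient (D.coloringSetoid ε₁ ε₂)) :
    D.uValue ε₁ ε₂ i j (conjClass σ ε₁ ε₂ q) = σ (D.uValue ε₁ ε₂ i j q) := by
  induction q using Quotient.inductionOn with
  | h a =>
    change detForm (conjColoring σ a.1 i) (conjColoring σ a.1 j) = σ (detForm (a.1 i) (a.1 j))
    simp [detForm, conjColoring]

theorem map_uPoly [Fintype (Quotient (D.coloringSetoid ε₁ ε₂))] (i j : Fin D.n) :
    (D.uPoly ε₁ ε₂ i j).map (σ : ℂ →+* ℂ) = D.uPoly ε₁ ε₂ i j := by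
  rw [uPoly, finprod_eq_prod_of_fintype, Polynomial.map_prod,
    ← (conjClass_bijective σ ε₁ ε₂).prod_comp fun q => X - C (D.uValue ε₁ ε₂ i j q)]
  exact Finset.prod_congr rfl fun q _ => by simp [uValue_conjClass]

end Galois

theorem rileyPoly_eq_prod {ε₁ ε₂ : Fin D.n → ℤˣ} [Fintype (Quotient (D.coloringSetoid ε₁ ε₂))]
    (h₁ : ∏ c, ε₁ c = 1) (h₂ : ∏ c, ε₂ c = -1) (i j : Fin D.n) :
    D.rileyPoly i j = ∏ q, (X - C (D.uValue ε₁ ε₂ i j q ^ 2)) := by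
  rw [rileyPoly, ← finprod_set_coe_eq_finprod_mem,
    ← finprod_eq_of_bijective _ (classCharacter_bijective h₁ h₂) fun q => rfl,
    finprod_eq_prod_of_fintype]
  refine Finset.prod_congr rfl fun q _ => ?_
  rw [classCharacter_gen_mul_gen]
  simp

end KnotDiagram

theorem Polynomial.prod_comp_neg_X {ι R : Type*} [CommRing R] (s : Finset ι) (u : ι → R) :
    C ((-1) ^ s.card) * (∏ q ∈ s, (X - C (u q))).comp (-X) = ∏ q ∈ s, (X + C (u q)) := by
  rw [Polynomial.prod_comp, C_pow, ← Finset.prod_const, ← Finset.prod_mul_distrib]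
  refine Finset.prod_congr rfl fun q _ => ?_
  simp
  ring

theorem mainTheorem4 (D : KnotDiagram) (εpos εneg : Fin D.n → ℤˣ)
    (hpos : ∏ c, εpos c = 1) (hneg : ∏ c, εneg c = -1) (i j : Fin D.n) :
    D.Xpar0.Finite ∧ Finite (Quotient (D.coloringSetoid εpos εneg)) ∧
      ∃ R g : ℚ[X],
        R.map (algebraMap ℚ ℂ) = D.rileyPoly i j ∧
        g.map (algebraMap ℚ ℂ) = D.uPoly εpos εneg i j ∧
        R.comp (X ^ 2) = g * starPoly g := by
  have hX := D.finite_Xpar0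
  have : Finite D.Xpar0 := hX
  have hQ : Finite (Quotient (D.coloringSetoid εpos εneg)) :=
    Finite.of_injective _ (KnotDiagram.classCharacter_bijective hpos hneg).1
  refine ⟨hX, hQ, ?_⟩
  have := Fintype.ofFinite (Quotient (D.coloringSetoid εpos εneg))
  obtain ⟨g, hg⟩ := Polynomial.exists_map_rat_eq_of_forall_ringEquiv fun σ =>
    KnotDiagram.map_uPoly σ εpos εneg i j
  have hu : D.uPoly εpos εneg i j = ∏ q, (X - C (D.uValue εpos εneg i j q)) :=
    finprod_eq_prod_of_fintype _
  have hdeg : g.natDegree = Fintype.card (Quotient (D.coloringSetoid εpos εneg)) := by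
    rw [← Polynomial.natDegree_map (algebraMap ℚ ℂ), hg, hu,
      Polynomial.natDegree_finsetProd_X_sub_C_eq_card]
    rfl
  have hstar : (g * starPoly g).map (algebraMap ℚ ℂ) = expand ℂ 2 (D.rileyPoly i j) := by
    have h1 : (starPoly g).map (algebraMap ℚ ℂ) = ∏ q, (X + C (D.uValue εpos εneg i j q)) := by
      rw [← Polynomial.prod_comp_neg_X, ← hu, ← hg, starPoly, hdeg]
      simp [Polynomial.map_comp]
    rw [Polynomial.map_mul, h1, hg, hu, D.rileyPoly_eq_prod hpos hneg, map_prod,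
      ← Finset.prod_mul_distrib]
    refine Finset.prod_congr rfl fun q _ => ?_
    simp
    ring
  have hR : (contract 2 (g * starPoly g)).map (algebraMap ℚ ℂ) = D.rileyPoly i j := by
    rw [Polynomial.map_contract two_ne_zero, hstar, contract_expand 2 two_ne_zero]
  refine ⟨contract 2 (g * starPoly g), g, hR, hg, ?_⟩
  apply Polynomial.map_injective (algebraMap ℚ ℂ) (algebraMap ℚ ℂ).injective
  rw [hstar, Polynomial.map_comp, hR, expand_eq_comp_X_pow]
  simp
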